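/- An effect algebra is a partial algebra $(E;\oplus,0,1)$ with $0\neq 1$ and a partial binary operation $\oplus$ such that, for all $x,y,z\in E$: $x\oplus y=y\oplus x$ if $x\oplus y$ is defined; $(x\oplus y)\oplus z=x\oplus(y\oplus z)$ if one side is defined; there is a unique $x'\in E$ with $x\oplus x'=1$; and if $1\oplus x$ is defined, then $x=0$. It is partially ordered by $x\le y$ iff $x\oplus z=y$ for some $z$. It has the Riesz decomposition property (RDP) if $u\le v_1\oplus v_2$ implies $u=u_1\oplus u_2$ for some $u_1\le v_1$, $u_2\le v_2$, and it is homogeneous if this holds whenever $u\le v_1\oplus v_2\le u'$. It is orthocomplete if, for every family $(x_i)_{i\in H}$ of elements such that the orthosum $\bigoplus_{i\in K}x_i$ exists for every finite $K\subseteq H$ and such that these finite orthosums have a common upper bound, the set of these finite orthosums has a supremum in $E$. A sub-effect algebra of $E$ is a subset $Q\ni 1$ such that, whenever $x\oplus y=z$ and two of $x,y,z$ are in $Q$, so is the third; it is an effect algebra with the inherited operation. A block of $E$ is a maximal sub-effect algebra of $E$ with RDP. An MV-effect algebra is an effect algebra with RDP whose partial order is a lattice. Let $E$ be a homogeneous orthocomplete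 effect algebra. Then every block $B$ of $E$ is an MV-algebra. That is, $B$ with the inherited operation is an MV-effect algebra, and there is an MV-algebra $(B;+,\neg,0)$ with the same zero and with $\neg x=x'$ such that, for all $x,y,z\in B$, $x\oplus y$ is defined in $B$ and equals $z$ if and only if $\neg x+\neg y=\neg 0$ and $x+y=z$. -/

import Mathlib

universe u

/-- Effect algebras.  The partial operation `⊕` is a function with values in `Option E`: the value
`some z` means that `x ⊕ y` is defined and equal to `z`, and `none` that it is undefined. -/
class EffectAlgebra (E : Type u) extends Zero E, One E where
  oplus : E → E → Option E
  zero_ne_one' : (0 : E) ≠ 1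
  oplus_comm' : ∀ x y : E, oplus x y = oplus y x
  /-- `(x ⊕ y) ⊕ z = x ⊕ (y ⊕ z)`: if one side is defined, so is the other, and they are equal. -/
  oplus_assoc' : ∀ x y z : E,
    ((oplus x y).bind fun s => oplus s z) = ((oplus y z).bind fun t => oplus x t)
  existsUnique_orthosupplement : ∀ x : E, ∃! y : E, oplus x y = some 1
  eq_zero_of_one_oplus : ∀ x z : E, oplus 1 x = some z → x = 0

namespace EffectAlgebra

infixl:65 " ⊕ₑ " => EffectAlgebra.oplus

section Basic

variable {E : Type u} [EffectAlgebra E]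

/-- The orthosupplement `x'` of `x`: the unique element with `x ⊕ x' = 1`. -/
noncomputable def compl (x : E) : E := (existsUnique_orthosupplement x).choose

theorem oplus_compl (x : E) : x ⊕ₑ compl x = some 1 :=
  (existsUnique_orthosupplement x).choose_spec.1

theorem eq_of_oplus_eq_one {x y z : E} (hy : x ⊕ₑ y = some 1) (hz : x ⊕ₑ z = some 1) : y = z :=
  (existsUnique_orthosupplement x).unique hy hz

theorem assoc_right {x y z s t : E} (hs : x ⊕ₑ y = some s) (ht : s ⊕ₑ z = some t) :
    ∃ r, y ⊕ₑ z = some r ∧ x ⊕ₑ r = some t := by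
  have h := oplus_assoc' x y z
  rw [hs, Option.bind_some, ht] at h
  exact Option.bind_eq_some_iff.1 h.symm

theorem assoc_left {x y z r t : E} (hr : y ⊕ₑ z = some r) (ht : x ⊕ₑ r = some t) :
    ∃ s, x ⊕ₑ y = some s ∧ s ⊕ₑ z = some t := by
  have h := oplus_assoc' x y z
  rw [hr, Option.bind_some, ht] at h
  exact Option.bind_eq_some_iff.1 h

theorem oplus_zero (x : E) : x ⊕ₑ 0 = some x := by
  have h1 : (1 : E) ⊕ₑ 0 = some 1 := by
    have h := oplus_compl (1 : E)
    rwa [eq_zero_of_one_oplus _ _ h] at h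
  have hx : compl x ⊕ₑ x = some 1 := by rw [oplus_comm', oplus_compl]
  obtain ⟨r, hr, hr1⟩ := assoc_right hx h1
  rw [hr, eq_of_oplus_eq_one hr1 hx]

theorem oplus_left_cancel {x y z w : E} (hy : x ⊕ₑ y = some w) (hz : x ⊕ₑ z = some w) :
    y = z := by
  have hw : compl w ⊕ₑ w = some 1 := by rw [oplus_comm', oplus_compl]
  obtain ⟨s, hs, hs1⟩ := assoc_left hy hw
  obtain ⟨t, ht, ht1⟩ := assoc_left hz hw
  obtain rfl : s = t := Option.some.inj (hs.symm.trans ht)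
  exact eq_of_oplus_eq_one hs1 ht1

theorem eq_zero_of_oplus_eq_zero {a b : E} (h : a ⊕ₑ b = some 0) : b = 0 := by
  have h1 : (1 : E) ⊕ₑ 0 = some 1 := oplus_zero 1
  rw [oplus_comm'] at h1 h
  rw [oplus_comm'] at h1
  obtain ⟨s, hs, -⟩ := assoc_left h h1
  exact eq_zero_of_one_oplus _ _ hs

/-- The partial order of an effect algebra: `x ≤ y` iff `x ⊕ z = y` for some `z`. -/
instance toPartialOrder : PartialOrder E where
  le x y := ∃ z, x ⊕ₑ z = some y
  le_refl x := ⟨0, oplus_zero x⟩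
  le_trans x y w := by
    rintro ⟨a, ha⟩ ⟨b, hb⟩
    obtain ⟨r, -, hr⟩ := assoc_right ha hb
    exact ⟨r, hr⟩
  le_antisymm x y := by
    rintro ⟨a, ha⟩ ⟨b, hb⟩
    obtain ⟨r, hr, hr'⟩ := assoc_right ha hb
    obtain rfl : r = 0 := oplus_left_cancel hr' (oplus_zero x)
    rw [oplus_comm'] at hr
    obtain rfl : a = 0 := eq_zero_of_oplus_eq_zero hr
    exact Option.some.inj ((oplus_zero x).symm.trans ha)

theorem le_iff {x y : E} : x ≤ y ↔ ∃ z, x ⊕ₑ z = some y := Iff.rfl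

/-- The operation `⊕` on possibly undefined elements: it is defined iff both arguments are and
their sum is. -/
def oplusOption (a b : Option E) : Option E := a.bind fun x => b.bind fun y => x ⊕ₑ y

instance : Std.Commutative (oplusOption (E := E)) where
  comm a b := by
    cases a <;> cases b <;> simp [oplusOption, oplus_comm']

instance : Std.Associative (oplusOption (E := E)) where
  assoc a b c := by
    rcases a with _ | x
    · simp [oplusOption]
    rcases b with _ | y
    · simp [oplusOption]
    rcases c with _ | z
    · simp [oplusOption]
    · simpa [oplusOption] using oplus_assoc' x y z

/-- The orthosum `⨁_{i ∈ K} x i` of a finite subsystem, if it exists: the iterated partial sum,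
starting from `⨁ ∅ = 0`. -/
def finOrthosum {H : Type u} (x : H → E) (K : Finset H) : Option E :=
  K.fold oplusOption (some 0) fun i => some (x i)

theorem finOrthosum_empty {H : Type u} (x : H → E) : finOrthosum x ∅ = some 0 := rfl

theorem finOrthosum_insert {H : Type u} [DecidableEq H] (x : H → E) {K : Finset H} {i : H}
    (hi : i ∉ K) : finOrthosum x (insert i K) = (finOrthosum x K).bind fun s => s ⊕ₑ x i := by
  rw [finOrthosum, Finset.fold_insert hi, Std.Commutative.comm (op := oplusOption (E := E))]
  rfl

/-- A system is orthogonal if all its finite subsystems have an orthosum. -/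
def IsOrthogonal {H : Type u} (x : H → E) : Prop :=
  ∀ K : Finset H, ∃ s, finOrthosum x K = some s

/-- The set of all orthosums of finite subsystems. -/
def finOrthosums {H : Type u} (x : H → E) : Set E :=
  {s | ∃ K : Finset H, finOrthosum x K = some s}

/-- `s` is the orthogonal sum of the orthogonal system `x`. -/
def IsOrthosum {H : Type u} (x : H → E) (s : E) : Prop := IsLUB (finOrthosums x) s

end Basic

section Properties

variable (E : Type u) [EffectAlgebra E]

/-- Every bounded orthogonal system is orthosummable. -/
def IsOrthocomplete : Prop :=
  ∀ (H : Type u) (x : H → E), IsOrthogonal x → BddAbove (finOrthosums x) → ∃ s, IsOrthosum x s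

/-- If `u ≤ v₁ ⊕ v₂ ≤ u'`, then `u = u₁ ⊕ u₂` for some `u₁ ≤ v₁` and `u₂ ≤ v₂`. -/
def IsHomogeneous : Prop :=
  ∀ u v₁ v₂ v : E, v₁ ⊕ₑ v₂ = some v → u ≤ v → v ≤ compl u →
    ∃ u₁ u₂ : E, u₁ ≤ v₁ ∧ u₂ ≤ v₂ ∧ u₁ ⊕ₑ u₂ = some u

/-- The Riesz decomposition property. -/
def HasRDP : Prop :=
  ∀ u v₁ v₂ v : E, v₁ ⊕ₑ v₂ = some v → u ≤ v →
    ∃ u₁ u₂ : E, u₁ ≤ v₁ ∧ u₂ ≤ v₂ ∧ u₁ ⊕ₑ u₂ = some u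

/-- The partial order of `E` is a lattice. -/
def IsLatticeOrdered : Prop :=
  ∀ x y : E, (∃ s, IsLUB {x, y} s) ∧ ∃ i, IsGLB {x, y} i

/-- A lattice effect algebra with the Riesz decomposition property. -/
def IsMVEffectAlgebra : Prop := IsLatticeOrdered E ∧ HasRDP E

end Properties

end EffectAlgebra

open EffectAlgebra in
/-- Sub-effect algebras: they contain `1`, and if two of `x, y, z` with `x ⊕ y = z` belong to
them, so does the third. -/
structure SubEffectAlgebra (E : Type u) [EffectAlgebra E] where
  carrier : Set E
  one_mem : 1 ∈ carrier
  sum_mem : ∀ {x y z : E}, x ⊕ₑ y = some z → x ∈ carrier → y ∈ carrier → z ∈ carrier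
  right_mem : ∀ {x y z : E}, x ⊕ₑ y = some z → x ∈ carrier → z ∈ carrier → y ∈ carrier
  left_mem : ∀ {x y z : E}, x ⊕ₑ y = some z → y ∈ carrier → z ∈ carrier → x ∈ carrier

namespace SubEffectAlgebra

open EffectAlgebra

variable {E : Type u} [EffectAlgebra E]

theorem carrier_injective : Function.Injective (carrier : SubEffectAlgebra E → Set E) := by
  rintro ⟨_, _, _, _, _⟩ ⟨_, _, _, _, _⟩ rfl
  rfl

/-- Sub-effect algebras are ordered by inclusion. -/
instance : PartialOrder (SubEffectAlgebra E) := PartialOrder.lift carrier carrier_injective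

theorem zero_mem (Q : SubEffectAlgebra E) : 0 ∈ Q.carrier :=
  Q.right_mem (oplus_zero 1) Q.one_mem Q.one_mem

/-- The type of elements of a sub-effect algebra `Q`. -/
structure Elem (Q : SubEffectAlgebra E) : Type u where
  val : E
  val_mem : val ∈ Q.carrier

theorem Elem.val_injective {Q : SubEffectAlgebra E} : Function.Injective (Elem.val (Q := Q)) := by
  rintro ⟨_, _⟩ ⟨_, _⟩ rfl
  rfl

/-- The inherited partial operation on a sub-effect algebra. -/
def oplusElem (Q : SubEffectAlgebra E) (x y : Q.Elem) : Option Q.Elem :=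
  (x.val ⊕ₑ y.val).pmap Elem.mk
    fun _ hz => Q.sum_mem hz x.val_mem y.val_mem

theorem map_val_oplusElem (Q : SubEffectAlgebra E) (x y : Q.Elem) :
    (Q.oplusElem x y).map Elem.val = x.val ⊕ₑ y.val := by
  rw [oplusElem, Option.map_pmap]
  exact (Option.pmap_eq_map (p := fun z => z ∈ Q.carrier) (f := fun z => z) _ _).trans
    (by simp)

theorem oplusElem_eq_some_iff (Q : SubEffectAlgebra E) {x y z : Q.Elem} :
    Q.oplusElem x y = some z ↔ x.val ⊕ₑ y.val = some z.val := by
  rw [← map_val_oplusElem]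
  exact (Option.map_injective Elem.val_injective).eq_iff.symm

/-- A sub-effect algebra with the inherited operation is an effect algebra. -/
instance (Q : SubEffectAlgebra E) : EffectAlgebra Q.Elem where
  zero := ⟨0, Q.zero_mem⟩
  one := ⟨1, Q.one_mem⟩
  oplus := Q.oplusElem
  zero_ne_one' h := zero_ne_one' (congrArg Elem.val h)
  oplus_comm' x y := by
    apply Option.map_injective Elem.val_injective
    rw [map_val_oplusElem, map_val_oplusElem, oplus_comm']
  oplus_assoc' x y z := by
    apply Option.map_injective Elem.val_injective
    have h := oplus_assoc' x.val y.val z.val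
    rw [← map_val_oplusElem, ← map_val_oplusElem, Option.bind_map, Option.bind_map] at h
    simpa [Option.map_bind, Function.comp_def, map_val_oplusElem] using h
  existsUnique_orthosupplement x := by
    refine ⟨⟨EffectAlgebra.compl x.val, Q.right_mem (oplus_compl x.val) x.val_mem Q.one_mem⟩, ?_, ?_⟩
    · exact Q.oplusElem_eq_some_iff.2 (oplus_compl x.val)
    · intro y hy
      exact Elem.val_injective
        (eq_of_oplus_eq_one (Q.oplusElem_eq_some_iff.1 hy) (oplus_compl x.val))
  eq_zero_of_one_oplus x z h :=
    Elem.val_injective (eq_zero_of_one_oplus x.val z.val (Q.oplusElem_eq_some_iff.1 h))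

/-- A block: a maximal sub-effect algebra with the Riesz decomposition property. -/
def IsBlock (B : SubEffectAlgebra E) : Prop :=
  Maximal (fun Q : SubEffectAlgebra E => HasRDP Q.Elem) B

end SubEffectAlgebra

/-- MV-algebras `(M; +, ¬, 0)`. -/
structure MVAlgebra (M : Type u) where
  add : M → M → M
  neg : M → M
  zero : M
  add_assoc : ∀ x y z, add (add x y) z = add x (add y z)
  add_comm : ∀ x y, add x y = add y x
  add_zero : ∀ x, add x zero = x
  neg_neg : ∀ x, neg (neg x) = x
  add_neg_zero : ∀ x, add x (neg zero) = neg zero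
  lukasiewicz : ∀ x y, add (neg (add (neg x) y)) y = add (neg (add (neg y) x)) x

open EffectAlgebra in
/-- The effect algebra operations of `E` are those derived from the MV-algebra `A`: both have the
same zero and the same complement, and `x ⊕ y` is defined iff `x` lies below `¬ y` in `A`, that is
`¬ x + ¬ y = ¬ 0`, in which case `x ⊕ y = x + y`. -/
def MVAlgebra.Induces {E : Type u} [EffectAlgebra E] (A : MVAlgebra E) : Prop :=
  A.zero = 0 ∧ (∀ x, A.neg x = EffectAlgebra.compl x) ∧
    ∀ x y z, x ⊕ₑ y = some z ↔ A.add (A.neg x) (A.neg y) = A.neg A.zero ∧ A.add x y = z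

/-! A block has RDP by definition, so what is missing is the lattice order; the MV-algebra then
comes from the truncated sum `x ⊕ (x' ∧ y)`.

The key fact, `IsBlock.mem_of_le`, is that a block contains every `u` of `E` with `u ≤ x` and `u ≤
x'` for some member `x`. To see this, start from the finite decompositions of unity in the block and
repeatedly cut a member along an element lying below another member. Two members `p`, `q` of such a
family satisfy `p ≤ q'`, so any `u` below both has `u ≤ p ≤ u'`, and homogeneity can distribute `u`
over any refinement of `p` or of `q`. Hence cuts can be carried over to refinements
(`SplitStep.exists_of_refines`), and any two families so obtained have a common refinement. The sums
of subfamilies therefore form a sub-effect algebra with RDP containing the block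
(`hasRDP_partitionSubalgebra`), and maximality makes it equal to the block.

For meets, RDP writes `x = p ⊕ q` and `y = p ⊕ r` with `q ≤ r'`. Orthocompleteness gives a lower
bound `w` of `q` and `r` in `E` that cannot be enlarged; as `w ≤ q` and `w ≤ q'`, it lies in the
block. By RDP, `p ⊕ w` is then the meet of `x` and `y`. -/

namespace EffectAlgebra

/-! ### Partial sums as a commutative monoid on `Option E` -/

section Sums

variable {E : Type u} [EffectAlgebra E]

/-- Possibly undefined elements form a commutative monoid under the extended operation. -/
instance optionAddCommMonoid : AddCommMonoid (Option E) where
  add := oplusOption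
  zero := some 0
  add_assoc := Std.Associative.assoc (op := oplusOption (E := E))
  add_comm := Std.Commutative.comm (op := oplusOption (E := E))
  zero_add a := by
    cases a with
    | none => rfl
    | some x => exact (oplus_comm' 0 x).trans (oplus_zero x)
  add_zero a := by
    cases a with
    | none => rfl
    | some x => exact oplus_zero x
  nsmul n a := n.rec (some 0) fun _ b => oplusOption b a
  nsmul_zero _ := rfl
  nsmul_succ _ _ := rfl

theorem some_add_some (x y : E) : some x + some y = x ⊕ₑ y := rfl

theorem some_zero : (some 0 : Option E) = 0 := rfl

theorem exists_of_add_eq_some {a b : Option E} {z : E} (h : a + b = some z) :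
    ∃ x y, a = some x ∧ b = some y := by
  rcases a with _ | x
  · cases h
  rcases b with _ | y
  · cases h
  exact ⟨x, y, rfl, rfl⟩

theorem add_left_cancel_some {a b : Option E} {x w : E} (ha : some x + a = some w)
    (hb : some x + b = some w) : a = b := by
  obtain ⟨_, y, -, rfl⟩ := exists_of_add_eq_some ha
  obtain ⟨_, z, -, rfl⟩ := exists_of_add_eq_some hb
  rw [oplus_left_cancel ha hb]

theorem le_of_add {x : E} {a : Option E} {z : E} (h : some x + a = some z) : x ≤ z := by
  obtain ⟨_, y, -, rfl⟩ := exists_of_add_eq_some h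
  exact ⟨y, h⟩

theorem exists_add_of_le {x z : E} (h : x ≤ z) : ∃ y, some x + some y = some z := h

theorem add_compl (x : E) : some x + some (compl x) = some 1 := oplus_compl x

theorem zero_le (x : E) : 0 ≤ x := le_of_add (zero_add (some x))

theorem le_one (x : E) : x ≤ 1 := le_of_add (add_compl x)

theorem eq_zero_of_le_zero {x : E} (h : x ≤ 0) : x = 0 := le_antisymm h (zero_le x)

theorem eq_compl {x y : E} (h : some x + some y = some 1) : y = compl x :=
  eq_of_oplus_eq_one h (oplus_compl x)

theorem compl_compl (x : E) : compl (compl x) = x :=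
  (eq_compl (by rw [add_comm, add_compl])).symm

theorem le_compl_of_add {x y z : E} (h : some x + some y = some z) : x ≤ compl y := by
  obtain ⟨t, ht⟩ := exists_add_of_le (le_one z)
  rw [← h, add_assoc, add_comm, add_assoc] at ht
  obtain ⟨_, r, -, hr⟩ := exists_of_add_eq_some ht
  rw [hr] at ht
  rw [← eq_compl ht]
  exact le_of_add ((add_comm _ _).trans hr)

theorem add_of_le_compl {x y : E} (h : x ≤ compl y) : ∃ z, some x + some y = some z := by
  obtain ⟨t, ht⟩ := h
  have h1 := add_compl y
  rw [← ht, ← some_add_some, ← add_assoc] at h1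
  obtain ⟨z, _, hz, -⟩ := exists_of_add_eq_some h1
  exact ⟨z, (add_comm _ _).trans hz⟩

theorem le_compl_comm {x y : E} (h : x ≤ compl y) : y ≤ compl x := by
  obtain ⟨z, hz⟩ := add_of_le_compl h
  exact le_compl_of_add ((add_comm _ _).trans hz)

theorem compl_le_compl {x y : E} (h : x ≤ y) : compl y ≤ compl x :=
  le_compl_comm (by rwa [compl_compl])

theorem add_le_add_some {x y x' y' s s' : E} (hx : x ≤ x') (hy : y ≤ y')
    (h : some x + some y = some s) (h' : some x' + some y' = some s') : s ≤ s' := by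
  obtain ⟨a, ha⟩ := exists_add_of_le hx
  obtain ⟨b, hb⟩ := exists_add_of_le hy
  rw [← ha, ← hb, add_add_add_comm, h] at h'
  exact le_of_add h'

theorem le_of_add_le_add {x y z s t : E} (hs : some x + some y = some s)
    (ht : some x + some z = some t) (h : s ≤ t) : y ≤ z := by
  obtain ⟨a, ha⟩ := exists_add_of_le h
  rw [← hs, add_assoc] at ha
  exact le_of_add (add_left_cancel_some ha ht)

theorem IsHomogeneous.split (hhom : IsHomogeneous E) {u a b v : E}
    (h : some a + some b = some v) (hu : u ≤ v) (hv : v ≤ compl u) :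
    ∃ u₁ u₂, u₁ ≤ a ∧ u₂ ≤ b ∧ some u₁ + some u₂ = some u :=
  hhom u a b v h hu hv

/-- The sum of a finite multiset, if it exists. -/
def msum (m : Multiset E) : Option E := (m.map some).sum

theorem msum_zero : msum (0 : Multiset E) = some 0 := by simp [msum, some_zero]

theorem msum_cons (a : E) (m : Multiset E) : msum (a ::ₘ m) = some a + msum m := by simp [msum]

theorem msum_add (m n : Multiset E) : msum (m + n) = msum m + msum n := by simp [msum]

theorem msum_cons_eq_some {a s : E} {m : Multiset E} (h : msum (a ::ₘ m) = some s) :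
    ∃ t, msum m = some t ∧ some a + some t = some s := by
  rw [msum_cons] at h
  obtain ⟨_, t, -, ht⟩ := exists_of_add_eq_some h
  exact ⟨t, ht, by rwa [ht] at h⟩

theorem msum_add_eq_some {s : E} {m n : Multiset E} (h : msum (m + n) = some s) :
    ∃ a b, msum m = some a ∧ msum n = some b ∧ some a + some b = some s := by
  rw [msum_add] at h
  obtain ⟨a, b, ha, hb⟩ := exists_of_add_eq_some h
  exact ⟨a, b, ha, hb, by rwa [ha, hb] at h⟩

end Sums

/-! ### Refinements of multisets and elementary cuts -/

section Refinement

variable {E : Type u} [EffectAlgebra E]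

/-- `Q` refines `P`: it arises by replacing each member of `P` by a multiset summing to it. -/
def Refines (P Q : Multiset E) : Prop :=
  ∃ M : Multiset (Multiset E), M.map msum = P.map some ∧ M.join = Q

theorem Refines.zero : Refines (0 : Multiset E) 0 := ⟨0, by simp, by simp⟩

theorem Refines.cons {p : E} {m P Q : Multiset E} (hm : msum m = some p) (h : Refines P Q) :
    Refines (p ::ₘ P) (m + Q) := by
  obtain ⟨M, hM, rfl⟩ := h
  exact ⟨m ::ₘ M, by simp [hm, hM], by simp⟩

theorem Refines.eq_zero {Q : Multiset E} (h : Refines 0 Q) : Q = 0 := by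
  obtain ⟨M, hM, rfl⟩ := h
  obtain rfl : M = 0 := by simpa using hM
  simp

theorem Refines.exists_of_cons {p : E} {P Q : Multiset E} (h : Refines (p ::ₘ P) Q) :
    ∃ m Q', msum m = some p ∧ Refines P Q' ∧ Q = m + Q' := by
  classical
  obtain ⟨M, hM, rfl⟩ := h
  rw [Multiset.map_cons] at hM
  obtain ⟨m, hm, hmp, hM'⟩ := (Multiset.map_eq_cons _ _ _ _).2 hM
  refine ⟨m, (M.erase m).join, hmp, ⟨_, hM', rfl⟩, ?_⟩
  conv_lhs => rw [← Multiset.cons_erase hm]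
  simp

theorem Refines.refl (P : Multiset E) : Refines P P := by
  induction P using Multiset.induction_on with
  | empty => exact Refines.zero
  | cons p P ih =>
    exact Refines.cons (m := {p}) (by simp [msum]) ih

theorem Refines.add {P Q P' Q' : Multiset E} (h : Refines P Q) (h' : Refines P' Q') :
    Refines (P + P') (Q + Q') := by
  obtain ⟨M, hM, rfl⟩ := h
  obtain ⟨M', hM', rfl⟩ := h'
  exact ⟨M + M', by simp [hM, hM'], by simp⟩

theorem Refines.exists_of_add {A C Q : Multiset E} (h : Refines (A + C) Q) :
    ∃ A' C', Refines A A' ∧ Refines C C' ∧ Q = A' + C' := by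
  induction A using Multiset.induction_on generalizing Q with
  | empty => exact ⟨0, Q, Refines.zero, by simpa using h, by simp⟩
  | cons a A ih =>
    rw [Multiset.cons_add] at h
    obtain ⟨m, Q', hm, hQ', rfl⟩ := h.exists_of_cons
    obtain ⟨A', C', hA, hC, rfl⟩ := ih hQ'
    exact ⟨m + A', C', Refines.cons hm hA, hC, (add_assoc _ _ _).symm⟩

theorem Refines.msum_eq {P Q : Multiset E} (h : Refines P Q) : msum Q = msum P := by
  induction P using Multiset.induction_on generalizing Q with
  | empty => rw [h.eq_zero]
  | cons p P ih =>
    obtain ⟨m, Q', hm, hQ', rfl⟩ := h.exists_of_cons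
    rw [msum_add, hm, ih hQ', msum_cons]

theorem Refines.trans {P Q T : Multiset E} (h : Refines P Q) (h' : Refines Q T) :
    Refines P T := by
  induction P using Multiset.induction_on generalizing Q T with
  | empty =>
    obtain rfl := h.eq_zero
    exact h'
  | cons p P ih =>
    obtain ⟨m, Q', hm, hQ', rfl⟩ := h.exists_of_cons
    obtain ⟨A, C, hA, hC, rfl⟩ := h'.exists_of_add
    exact Refines.cons (hA.msum_eq.trans hm) (ih hQ' hC)

theorem Refines.of_add {p : E} {m : Multiset E} (h : msum m = some p) (R : Multiset E) :
    Refines (p ::ₘ R) (m + R) := Refines.cons h (Refines.refl R)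

/-- An elementary refinement step: a member `p` is split as `u ⊕ w`, where `u` lies below another
member `q`. -/
def SplitStep (P P' : Multiset E) : Prop :=
  ∃ (p q u w : E) (R : Multiset E), P = p ::ₘ q ::ₘ R ∧ P' = u ::ₘ w ::ₘ q ::ₘ R ∧
    some u + some w = some p ∧ u ≤ q

/-- `P'` arises from `P` by finitely many elementary refinement steps. -/
def SplitsTo : Multiset E → Multiset E → Prop := Relation.ReflTransGen SplitStep

theorem SplitsTo.refl (P : Multiset E) : SplitsTo P P := Relation.ReflTransGen.refl

theorem SplitStep.refines {P P' : Multiset E} (h : SplitStep P P') : Refines P P' := by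
  obtain ⟨p, q, u, w, R, rfl, rfl, hp, -⟩ := h
  have : u ::ₘ w ::ₘ q ::ₘ R = (u ::ₘ w ::ₘ 0) + (q ::ₘ R) := by
    simp only [Multiset.cons_add, zero_add]
  rw [this]
  refine Refines.of_add ?_ _
  rw [msum_cons, msum_cons, msum_zero, some_zero, add_zero, hp]

theorem SplitsTo.refines {P P' : Multiset E} (h : SplitsTo P P') : Refines P P' := by
  induction h with
  | refl => exact Refines.refl P
  | tail _ h ih => exact ih.trans h.refines

/-- A cut of `p` against `q` is carried over to a decomposition `m` of `p`: homogeneity distributes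
`u` over the members of `m`, and each share is still below `q`, so each member can be cut against
`q` itself. -/
theorem exists_splitsTo_of_le_mem (hhom : IsHomogeneous E) (q : E) (m : Multiset E) :
    ∀ (R : Multiset E) (p u w : E), msum m = some p → some u + some w = some p → u ≤ q →
      p ≤ compl q → ∃ mu mw, msum mu = some u ∧ msum mw = some w ∧
        SplitsTo (m + q ::ₘ R) (mu + mw + q ::ₘ R) := by
  induction m using Multiset.induction_on with
  | empty =>
    intro R p u w hp hu _ _
    rw [msum_zero] at hp
    obtain rfl := Option.some.inj hp
    obtain rfl := eq_zero_of_le_zero (le_of_add hu)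
    obtain rfl := eq_zero_of_le_zero (le_of_add ((add_comm _ _).trans hu))
    exact ⟨0, 0, msum_zero, msum_zero, by simpa using SplitsTo.refl _⟩
  | cons a m ih =>
    intro R p u w hp hu huq hpq
    obtain ⟨p₁, hp₁, hap⟩ := msum_cons_eq_some hp
    obtain ⟨u₁, u₂, hu₁, hu₂, hu₁₂⟩ :=
      hhom.split hap (le_of_add hu) (hpq.trans (compl_le_compl huq))
    obtain ⟨a₁, ha₁⟩ := exists_add_of_le hu₁
    obtain ⟨w₂, hw₂⟩ := exists_add_of_le hu₂
    have hw : some a₁ + some w₂ = some w := by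
      rw [← ha₁, ← hw₂, add_add_add_comm, hu₁₂] at hap
      exact add_left_cancel_some hap hu
    obtain ⟨mu, mw, hmu, hmw, h⟩ := ih (u₁ ::ₘ a₁ ::ₘ R) p₁ u₂ w₂ hp₁ hw₂
      ((le_of_add ((add_comm _ _).trans hu₁₂)).trans huq)
      ((le_of_add ((add_comm _ _).trans hap)).trans hpq)
    refine ⟨u₁ ::ₘ mu, a₁ ::ₘ mw, by rw [msum_cons, hmu, hu₁₂], by rw [msum_cons, hmw, hw],
      Relation.ReflTransGen.head (b := m + q ::ₘ u₁ ::ₘ a₁ ::ₘ R) ?_ ?_⟩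
    · refine ⟨a, q, u₁, a₁, m + R, ?_, ?_, ha₁, (le_of_add hu₁₂).trans huq⟩
      · simp [Multiset.cons_swap]
      · simp only [← Multiset.singleton_add]; abel
    · have e : u₁ ::ₘ mu + a₁ ::ₘ mw + q ::ₘ R = mu + mw + q ::ₘ u₁ ::ₘ a₁ ::ₘ R := by
        simp only [← Multiset.singleton_add]; abel
      rw [e]
      exact h

/-- Here `q` is decomposed as well. Homogeneity distributes `u` over the members of `n`, and its
shares are cut off `m` one after another, each against its own member of `n`. -/
theorem exists_splitsTo_of_le (hhom : IsHomogeneous E) (n : Multiset E) :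
    ∀ (m R : Multiset E) (p q u w : E), msum m = some p → msum n = some q →
      some u + some w = some p → u ≤ q → p ≤ compl q →
      ∃ mu mw, msum mu = some u ∧ msum mw = some w ∧
        SplitsTo (m + n + R) (mu + mw + n + R) := by
  induction n using Multiset.induction_on with
  | empty =>
    intro m R p q u w hp hq hu huq _
    rw [msum_zero] at hq
    obtain rfl := Option.some.inj hq
    obtain rfl := eq_zero_of_le_zero huq
    rw [some_zero, zero_add] at hu
    exact ⟨0, m, msum_zero, hp.trans hu.symm, by simpa using SplitsTo.refl _⟩
  | cons b n ih =>
    intro m R p q u w hp hq hu huq hpq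
    obtain ⟨q₁, hq₁, hbq⟩ := msum_cons_eq_some hq
    have hup := le_of_add hu
    -- Homogeneity applies because `u ≤ p ≤ q'` gives `q ≤ u'`.
    obtain ⟨s, t, hs, ht, hst⟩ := hhom.split hbq huq (le_compl_comm (hup.trans hpq))
    rw [← hst, add_assoc] at hu
    obtain ⟨_, v, -, hv⟩ := exists_of_add_eq_some hu
    rw [hv] at hu
    obtain ⟨ms, mv, hms, hmv, h₁⟩ := exists_splitsTo_of_le_mem hhom b m (n + R) p s v hp hu hs
      (hpq.trans (compl_le_compl (le_of_add hbq)))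
    obtain ⟨mt, mw, hmt, hmw, h₂⟩ := ih mv (b ::ₘ ms + R) v q₁ t w hmv hq₁ hv ht
      (((le_of_add ((add_comm _ _).trans hu)).trans hpq).trans
        (compl_le_compl (le_of_add ((add_comm _ _).trans hbq))))
    refine ⟨ms + mt, mw, by rw [msum_add, hms, hmt, hst], hmw, ?_⟩
    have e₁ : m + b ::ₘ n + R = m + b ::ₘ (n + R) := by simp [add_assoc]
    have e₂ : ms + mv + b ::ₘ (n + R) = mv + n + (b ::ₘ ms + R) := by
      simp only [← Multiset.singleton_add]; abel
    have e₃ : ms + mt + mw + b ::ₘ n + R = mt + mw + n + (b ::ₘ ms + R) := by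
      simp only [← Multiset.singleton_add]; abel
    rw [e₁, e₃]
    rw [e₂] at h₁
    exact Relation.ReflTransGen.trans h₁ h₂

/-- Summability of `P` is needed because it makes `p` and `q` orthogonal, the condition for
distributing the cut over the refinements of both. -/
theorem SplitStep.exists_of_refines (hhom : IsHomogeneous E) {P P' Q : Multiset E} {s : E}
    (hP : msum P = some s) (h : SplitStep P P') (hQ : Refines P Q) :
    ∃ Q', SplitsTo Q Q' ∧ Refines P' Q' := by
  obtain ⟨p, q, u, w, R, rfl, rfl, hu, huq⟩ := h
  obtain ⟨m, Q₁, hm, hQ₁, rfl⟩ := hQ.exists_of_cons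
  obtain ⟨n, Q₂, hn, hQ₂, rfl⟩ := hQ₁.exists_of_cons
  rw [msum_cons, msum_cons, ← add_assoc] at hP
  obtain ⟨r, _, hr, -⟩ := exists_of_add_eq_some hP
  obtain ⟨mu, mw, hmu, hmw, h⟩ := exists_splitsTo_of_le hhom n m Q₂ p q u w hm hn hu huq
    (le_compl_of_add hr)
  refine ⟨_, by rwa [← add_assoc], ?_⟩
  rw [add_assoc, add_assoc]
  exact Refines.cons hmu (Refines.cons hmw (Refines.cons hn hQ₂))

theorem SplitsTo.exists_of_refines (hhom : IsHomogeneous E) {P P' Q : Multiset E} {s : E}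
    (hP : msum P = some s) (h : SplitsTo P P') (hQ : Refines P Q) :
    ∃ Q', SplitsTo Q Q' ∧ Refines P' Q' := by
  induction h with
  | refl => exact ⟨Q, Relation.ReflTransGen.refl, hQ⟩
  | @tail P₁ P₂ h₁ h₂ ih =>
    obtain ⟨Q₁, hQ₁, hr⟩ := ih
    have hs : msum P₁ = some s := (SplitsTo.refines h₁).msum_eq.trans hP
    obtain ⟨Q₂, hQ₂, hr₂⟩ := h₂.exists_of_refines hhom hs hr
    exact ⟨Q₂, Relation.ReflTransGen.trans hQ₁ hQ₂, hr₂⟩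

end Refinement

end EffectAlgebra

namespace SubEffectAlgebra

open EffectAlgebra

variable {E : Type u} [EffectAlgebra E]

theorem Elem.le_iff {Q : SubEffectAlgebra E} {x y : Q.Elem} : x ≤ y ↔ x.val ≤ y.val := by
  constructor
  · rintro ⟨z, hz⟩
    exact ⟨z.val, Q.oplusElem_eq_some_iff.1 hz⟩
  · rintro ⟨z, hz⟩
    exact ⟨⟨z, Q.right_mem hz x.val_mem y.val_mem⟩, Q.oplusElem_eq_some_iff.2 hz⟩

/-- The Riesz decomposition property of a sub-effect algebra in terms of the ambient algebra. -/
theorem hasRDP_iff (Q : SubEffectAlgebra E) : HasRDP Q.Elem ↔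
    ∀ u a b v : E, u ∈ Q.carrier → a ∈ Q.carrier → b ∈ Q.carrier → some a + some b = some v →
      u ≤ v → ∃ u₁ ∈ Q.carrier, ∃ u₂ ∈ Q.carrier, u₁ ≤ a ∧ u₂ ≤ b ∧
        some u₁ + some u₂ = some u := by
  constructor
  · intro h u a b v hu ha hb hv huv
    obtain ⟨u₁, u₂, h₁, h₂, h₁₂⟩ := h ⟨u, hu⟩ ⟨a, ha⟩ ⟨b, hb⟩ ⟨v, Q.sum_mem hv ha hb⟩
      (Q.oplusElem_eq_some_iff.2 hv) (Elem.le_iff.2 huv)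
    exact ⟨u₁.val, u₁.val_mem, u₂.val, u₂.val_mem, Elem.le_iff.1 h₁, Elem.le_iff.1 h₂,
      Q.oplusElem_eq_some_iff.1 h₁₂⟩
  · intro h u a b v hv huv
    obtain ⟨u₁, h₁, u₂, h₂, hu₁, hu₂, h₁₂⟩ := h u.val a.val b.val v.val u.val_mem a.val_mem
      b.val_mem (Q.oplusElem_eq_some_iff.1 hv) (Elem.le_iff.1 huv)
    exact ⟨⟨u₁, h₁⟩, ⟨u₂, h₂⟩, Elem.le_iff.2 hu₁, Elem.le_iff.2 hu₂, Q.oplusElem_eq_some_iff.2 h₁₂⟩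

/-! ### Common refinements inside a sub-effect algebra with RDP -/

section Refinement

variable {B : SubEffectAlgebra E}

theorem msum_mem {m : Multiset E} (hm : ∀ x ∈ m, x ∈ B.carrier) {s : E}
    (hs : msum m = some s) : s ∈ B.carrier := by
  induction m using Multiset.induction_on generalizing s with
  | empty =>
    rw [msum_zero] at hs
    exact Option.some.inj hs ▸ B.zero_mem
  | cons a m ih =>
    obtain ⟨t, ht, hat⟩ := msum_cons_eq_some hs
    exact B.sum_mem hat (hm a (Multiset.mem_cons_self a m))
      (ih (fun x hx => hm x (Multiset.mem_cons_of_mem hx)) ht)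

theorem exists_refines_of_msum_eq_add (hB : HasRDP B.Elem) {n : Multiset E}
    (hn : ∀ x ∈ n, x ∈ B.carrier) {a b v : E} (ha : a ∈ B.carrier) (hb : b ∈ B.carrier)
    (hab : some a + some b = some v) (hv : msum n = some v) :
    ∃ n₁ n₂ : Multiset E, (∀ x ∈ n₁, x ∈ B.carrier) ∧ (∀ x ∈ n₂, x ∈ B.carrier) ∧
      msum n₁ = some a ∧ msum n₂ = some b ∧ Refines n (n₁ + n₂) := by
  induction n using Multiset.induction_on generalizing a b v with
  | empty =>
    rw [msum_zero] at hv
    obtain rfl := Option.some.inj hv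
    obtain rfl := eq_zero_of_le_zero (le_of_add hab)
    obtain rfl := eq_zero_of_le_zero (le_of_add ((add_comm _ _).trans hab))
    exact ⟨0, 0, by simp, by simp, msum_zero, msum_zero, Refines.zero⟩
  | cons c n ih =>
    obtain ⟨d, hd, hcd⟩ := msum_cons_eq_some hv
    have hc := hn c (Multiset.mem_cons_self c n)
    have hn' : ∀ x ∈ n, x ∈ B.carrier := fun x hx => hn x (Multiset.mem_cons_of_mem hx)
    have hdB := msum_mem hn' hd
    -- RDP splits `a` along `c ⊕ d`; the complementary pieces `c₁` and `d₁` make up `b`.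
    obtain ⟨a₁, ha₁, a₂, ha₂, ha₁c, ha₂d, haa⟩ := B.hasRDP_iff.1 hB a c d v ha hc hdB hcd
      (le_of_add hab)
    obtain ⟨c₁, hc₁⟩ := exists_add_of_le ha₁c
    obtain ⟨d₁, hd₁⟩ := exists_add_of_le ha₂d
    have hc₁B := B.right_mem hc₁ ha₁ hc
    have hd₁B := B.right_mem hd₁ ha₂ hdB
    have hcdb : some c₁ + some d₁ = some b := by
      rw [← hc₁, ← hd₁, add_add_add_comm, haa] at hcd
      exact add_left_cancel_some hcd hab
    obtain ⟨n₁, n₂, hn₁, hn₂, hs₁, hs₂, hr⟩ := ih hn' ha₂ hd₁B hd₁ hd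
    refine ⟨a₁ ::ₘ n₁, c₁ ::ₘ n₂, ?_, ?_, by rw [msum_cons, hs₁, haa],
      by rw [msum_cons, hs₂, hcdb], ?_⟩
    · simpa [ha₁] using hn₁
    · simpa [hc₁B] using hn₂
    · have e : a₁ ::ₘ n₁ + c₁ ::ₘ n₂ = (a₁ ::ₘ c₁ ::ₘ 0) + (n₁ + n₂) := by
        simp only [← Multiset.singleton_add]; abel
      rw [e]
      refine Refines.cons ?_ hr
      rw [msum_cons, msum_cons, msum_zero, some_zero, add_zero, hc₁]

theorem refines_zero {n : Multiset E} (hn : msum n = some 0) : Refines n 0 := by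
  induction n using Multiset.induction_on with
  | empty => exact Refines.zero
  | cons a n ih =>
    obtain ⟨t, ht, hat⟩ := msum_cons_eq_some hn
    obtain rfl := eq_zero_of_le_zero (le_of_add hat)
    obtain rfl := eq_zero_of_le_zero (le_of_add ((add_comm _ _).trans hat))
    have := Refines.cons (m := 0) msum_zero (ih ht)
    rwa [zero_add] at this

/-- Finite decompositions of the same element have a common refinement. -/
theorem exists_common_refinement (hB : HasRDP B.Elem) {m n : Multiset E}
    (hm : ∀ x ∈ m, x ∈ B.carrier) (hn : ∀ x ∈ n, x ∈ B.carrier) {s : E}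
    (hms : msum m = some s) (hns : msum n = some s) :
    ∃ k : Multiset E, (∀ x ∈ k, x ∈ B.carrier) ∧ Refines m k ∧ Refines n k := by
  induction m using Multiset.induction_on generalizing n s with
  | empty =>
    rw [msum_zero] at hms
    obtain rfl := Option.some.inj hms
    exact ⟨0, by simp, Refines.zero, refines_zero hns⟩
  | cons a m ih =>
    obtain ⟨t, ht, hat⟩ := msum_cons_eq_some hms
    have hm' : ∀ x ∈ m, x ∈ B.carrier := fun x hx => hm x (Multiset.mem_cons_of_mem hx)
    obtain ⟨n₁, n₂, hn₁, hn₂, hs₁, hs₂, hr⟩ := exists_refines_of_msum_eq_add hB hn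
      (hm a (Multiset.mem_cons_self a m)) (msum_mem hm' ht) hat hns
    obtain ⟨k, hk, hmk, hnk⟩ := ih hm' hn₂ ht hs₂
    refine ⟨n₁ + k, ?_, Refines.cons hs₁ hmk, hr.trans ((Refines.refl n₁).add hnk)⟩
    intro x hx
    rcases Multiset.mem_add.1 hx with hx | hx
    exacts [hn₁ x hx, hk x hx]

/-! ### The sub-effect algebra generated by cuts of decompositions of unity -/

/-- `P` arises by elementary refinement steps from a decomposition of unity in `B`. -/
def IsPartition (B : SubEffectAlgebra E) (P : Multiset E) : Prop :=
  ∃ W : Multiset E, (∀ x ∈ W, x ∈ B.carrier) ∧ msum W = some 1 ∧ SplitsTo W P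

theorem IsPartition.splitsTo {P Q : Multiset E} (h : IsPartition B P) (hQ : SplitsTo P Q) :
    IsPartition B Q := by
  obtain ⟨W, hW, h1, hP⟩ := h
  exact ⟨W, hW, h1, Relation.ReflTransGen.trans hP hQ⟩

theorem IsPartition.msum_eq {P : Multiset E} (h : IsPartition B P) : msum P = some 1 := by
  obtain ⟨W, -, h1, hP⟩ := h
  exact hP.refines.msum_eq.trans h1

theorem IsPartition.exists_common_refinement (hhom : IsHomogeneous E) (hB : HasRDP B.Elem)
    {P Q : Multiset E} (hP : IsPartition B P) (hQ : IsPartition B Q) :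
    ∃ T, IsPartition B T ∧ Refines P T ∧ Refines Q T := by
  obtain ⟨W, hW, hW1, hWP⟩ := hP
  obtain ⟨V, hV, hV1, hVQ⟩ := hQ
  -- The starting decompositions are refined together inside `B`. The cuts leading to `P` are
  -- carried over to `U`, and those leading to `Q` to the result, which still refines `V`.
  obtain ⟨U, hU, hWU, hVU⟩ := SubEffectAlgebra.exists_common_refinement hB hW hV hW1 hV1
  obtain ⟨P', hUP', hPP'⟩ := hWP.exists_of_refines hhom hW1 hWU
  obtain ⟨Q', hP'Q', hQQ'⟩ := hVQ.exists_of_refines hhom hV1 (hVU.trans hUP'.refines)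
  exact ⟨Q', ⟨U, hU, hWU.msum_eq.trans hW1, Relation.ReflTransGen.trans hUP' hP'Q'⟩,
    hPP'.trans hP'Q'.refines, hQQ'⟩

/-- The sums of subfamilies of the partitions obtained from `B`. -/
def partitionSums (B : SubEffectAlgebra E) : Set E :=
  {a | ∃ A C : Multiset E, IsPartition B (A + C) ∧ msum A = some a}

theorem subset_partitionSums : B.carrier ⊆ partitionSums B := by
  intro a ha
  refine ⟨{a}, {compl a}, ⟨_, ?_, ?_, SplitsTo.refl _⟩, by simp [msum]⟩
  · intro x hx
    rcases Multiset.mem_add.1 hx with hx | hx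
    · rwa [Multiset.mem_singleton.1 hx]
    · rw [Multiset.mem_singleton.1 hx]
      exact B.right_mem (oplus_compl a) ha B.one_mem
  · rw [msum_add]
    simpa [msum] using add_compl a

/-- A single cut of `x` against `x'` in the decomposition `{x, x'}` isolates `u`. -/
theorem mem_partitionSums_of_le {u x : E} (hx : x ∈ B.carrier) (hu : u ≤ x)
    (hu' : u ≤ compl x) : u ∈ partitionSums B := by
  obtain ⟨w, hw⟩ := exists_add_of_le hu
  refine ⟨{u}, w ::ₘ compl x ::ₘ 0, ⟨x ::ₘ compl x ::ₘ 0, ?_, ?_, ?_⟩, by simp [msum]⟩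
  · have := B.right_mem (oplus_compl x) hx B.one_mem
    simp [hx, this]
  · simpa [msum] using add_compl x
  · refine Relation.ReflTransGen.single ⟨x, compl x, u, w, 0, rfl, ?_, hw, hu'⟩
    rw [Multiset.singleton_add]

theorem _root_.Multiset.exists_of_add_eq_add {α : Type*} {A C D F : Multiset α}
    (h : A + C = D + F) : ∃ X Y Z T, A = X + Y ∧ C = Z + T ∧ D = X + Z ∧ F = Y + T := by
  classical
  refine ⟨A ∩ D, A - D, D - A, F - (A - D), ?_, ?_, ?_, ?_⟩ <;>
  · ext x
    have := congrArg (Multiset.count x) h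
    simp only [Multiset.count_add, Multiset.count_inter, Multiset.count_sub] at this ⊢
    omega

theorem exists_partition_of_mem (hhom : IsHomogeneous E) (hB : HasRDP B.Elem) {a b : E}
    (ha : a ∈ partitionSums B) (hb : b ∈ partitionSums B) :
    ∃ X Y Z T, IsPartition B (X + Y + (Z + T)) ∧ msum (X + Y) = some a ∧
      msum (X + Z) = some b := by
  obtain ⟨A, C, hP, ha⟩ := ha
  obtain ⟨D, F, hQ, hb⟩ := hb
  obtain ⟨U, hU, hPU, hQU⟩ := hP.exists_common_refinement hhom hB hQ
  obtain ⟨A', C', hA, -, rfl⟩ := hPU.exists_of_add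
  obtain ⟨D', F', hD, -, h⟩ := hQU.exists_of_add
  obtain ⟨X, Y, Z, T, rfl, rfl, rfl, rfl⟩ := Multiset.exists_of_add_eq_add h
  exact ⟨X, Y, Z, T, hU, hA.msum_eq.trans ha, hD.msum_eq.trans hb⟩

/-- In a common refinement, `a = x ⊕ y` and `b = x ⊕ z` with common part `x`, so `y ≤ z`. Cutting
`Z` against the disjoint subfamily `Y` produces a copy of `y` inside `Z`, which replaces `Y` in
representing `a`. -/
theorem exists_partition_of_le (hhom : IsHomogeneous E) (hB : HasRDP B.Elem) {a b : E}
    (ha : a ∈ partitionSums B) (hb : b ∈ partitionSums B) (hab : a ≤ b) :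
    ∃ A D F, IsPartition B (A + D + F) ∧ msum A = some a ∧ msum (A + D) = some b := by
  obtain ⟨X, Y, Z, T, hP, ha, hb⟩ := exists_partition_of_mem hhom hB ha hb
  obtain ⟨x, y, hx, hy, hxy⟩ := msum_add_eq_some ha
  obtain ⟨x', z, hx', hz, hxz⟩ := msum_add_eq_some hb
  obtain rfl : x = x' := Option.some.inj (hx.symm.trans hx')
  have hyz : y ≤ z := le_of_add_le_add hxy hxz hab
  obtain ⟨w, hw⟩ := exists_add_of_le hyz
  have e : X + Y + (Z + T) = Z + Y + (X + T) := by abel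
  rw [e] at hP
  have hzy : z ≤ compl y := by
    obtain ⟨_, _, h, -, -⟩ := msum_add_eq_some hP.msum_eq
    rw [msum_add, hz, hy] at h
    exact le_compl_of_add h
  obtain ⟨mu, mw, hmu, hmw, h⟩ := exists_splitsTo_of_le hhom Y Z (X + T) z y y w hz hy hw le_rfl hzy
  refine ⟨X + mu, mw, Y + T, ?_, ?_, ?_⟩
  · convert hP.splitsTo h using 1
    abel
  · rw [msum_add, hx, hmu, hxy]
  · rw [msum_add, msum_add, hx, hmu, hmw, add_assoc, hw, hxz]

theorem partitionSums_right_mem (hhom : IsHomogeneous E) (hB : HasRDP B.Elem) {x y z : E}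
    (h : some x + some y = some z) (hx : x ∈ partitionSums B) (hz : z ∈ partitionSums B) :
    y ∈ partitionSums B := by
  obtain ⟨A, D, F, hP, hA, hAD⟩ := exists_partition_of_le hhom hB hx hz (le_of_add h)
  rw [msum_add, hA] at hAD
  refine ⟨D, A + F, ?_, add_left_cancel_some hAD h⟩
  convert hP using 1
  abel

theorem one_mem_partitionSums : 1 ∈ partitionSums B := subset_partitionSums B.one_mem

theorem partitionSums_sum_mem (hhom : IsHomogeneous E) (hB : HasRDP B.Elem) {x y z : E}
    (h : some x + some y = some z) (hx : x ∈ partitionSums B) (hy : y ∈ partitionSums B) :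
    z ∈ partitionSums B := by
  have hy' := partitionSums_right_mem hhom hB (add_compl y) hy one_mem_partitionSums
  -- Closure under sums reduces to closure under differences: `z' = y' ⊖ x`.
  have hxz : some x + some (compl z) = some (compl y) := by
    have h1 := add_compl z
    rw [← h, add_assoc, add_comm, add_assoc] at h1
    obtain ⟨_, r, -, hr⟩ := exists_of_add_eq_some h1
    rw [hr] at h1
    rw [← eq_compl h1, ← hr, add_comm]
  have hz' := partitionSums_right_mem hhom hB hxz hx hy'
  exact partitionSums_right_mem hhom hB ((add_comm _ _).trans (add_compl z)) hz'
    one_mem_partitionSums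

/-- The sub-effect algebra of all sums of subfamilies of partitions obtained from `B`. -/
def partitionSubalgebra (hhom : IsHomogeneous E) (hB : HasRDP B.Elem) : SubEffectAlgebra E where
  carrier := partitionSums B
  one_mem := one_mem_partitionSums
  sum_mem := partitionSums_sum_mem hhom hB
  right_mem := partitionSums_right_mem hhom hB
  left_mem h hy hz := partitionSums_right_mem hhom hB ((add_comm _ _).trans h) hy hz

/-- In a common refinement for `a`, `b` and `c`, only the part `c₃` of `c` outside both `a` and `b`
needs distributing. It fits below what `c` leaves free in `a` and `b`, and is orthogonal to it, so
homogeneity applies. -/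
theorem hasRDP_partitionSubalgebra (hhom : IsHomogeneous E) (hB : HasRDP B.Elem) :
    HasRDP (partitionSubalgebra hhom hB).Elem := by
  rw [hasRDP_iff]
  intro c a b v (hc : c ∈ partitionSums B) (ha : a ∈ partitionSums B) (hb : b ∈ partitionSums B)
    hv hcv
  change ∃ u₁ ∈ partitionSums B, ∃ u₂ ∈ partitionSums B, _
  obtain ⟨A, N, D, hP, hA, hAN⟩ := exists_partition_of_le hhom hB ha
    (partitionSums_right_mem hhom hB (add_compl b) hb one_mem_partitionSums) (le_compl_of_add hv)
  have hD : msum D = some b := by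
    have h1 := hP.msum_eq
    rw [msum_add, hAN] at h1
    exact add_left_cancel_some h1 ((add_comm _ _).trans (add_compl b))
  obtain ⟨C, F, hQ, hc⟩ := hc
  obtain ⟨U, hU, hPU, hQU⟩ := hP.exists_common_refinement hhom hB hQ
  obtain ⟨AN', D', hAN', hD', rfl⟩ := hPU.exists_of_add
  obtain ⟨A', N', hA', -, rfl⟩ := hAN'.exists_of_add
  obtain ⟨C', F', hC, -, h⟩ := hQU.exists_of_add
  replace hA := hA'.msum_eq.trans hA
  replace hD := hD'.msum_eq.trans hD
  replace hc := hC.msum_eq.trans hc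
  -- The `C`s make up `c` and the `R`s the rest; index 1 marks the part in `a`, 2 the part in `b`, 3
  -- the remainder.
  obtain ⟨C₁₃, R₁₃, C₂, R₂, h₁₃, rfl, rfl, rfl⟩ := Multiset.exists_of_add_eq_add h
  obtain ⟨C₁, R₁, C₃, R₃, rfl, rfl, rfl, rfl⟩ := Multiset.exists_of_add_eq_add h₁₃
  obtain ⟨c₁, e₁, hc₁, he₁, hce₁⟩ := msum_add_eq_some hA
  obtain ⟨c₂, e₂, hc₂, he₂, hce₂⟩ := msum_add_eq_some hD
  obtain ⟨c₁₃, c₂', hc₁₃, hc₂', hcc⟩ := msum_add_eq_some hc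
  obtain rfl : c₂ = c₂' := Option.some.inj (hc₂.symm.trans hc₂')
  obtain ⟨c₁', c₃, hc₁', hc₃, hcc'⟩ := msum_add_eq_some hc₁₃
  obtain rfl : c₁ = c₁' := Option.some.inj (hc₁.symm.trans hc₁')
  rw [← hce₁, ← hce₂, add_add_add_comm] at hv
  obtain ⟨c₁₂, e, hc₁₂, he⟩ := exists_of_add_eq_some hv
  have hc₁₂₃ : some c₁₂ + some c₃ = some c := by
    rw [← hc₁₂, ← hcc, ← hcc', add_right_comm]
  rw [hc₁₂, he] at hv
  have hc₃e : c₃ ≤ e := le_of_add_le_add hc₁₂₃ hv hcv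
  have hperm : ∃ R, C₁ + R₁ + (C₃ + R₃) + (C₂ + R₂) = R₁ + C₃ + R₂ + R ∧
      R = C₁ + R₃ + C₂ := ⟨_, by abel, rfl⟩
  obtain ⟨R, hR, hR'⟩ := hperm
  have hU1 := hU.msum_eq
  rw [hR] at hU1
  obtain ⟨_, _, hU2, -, -⟩ := msum_add_eq_some hU1
  rw [msum_add, msum_add, he₁, hc₃, he₂, add_right_comm, he] at hU2
  have hec₃ : e ≤ compl c₃ := le_compl_of_add hU2
  obtain ⟨d₁, d₂, hd₁, hd₂, hd⟩ := hhom.split he hc₃e hec₃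
  obtain ⟨f₁, hf₁⟩ := exists_add_of_le hd₁
  -- Cutting `R₁` against `C₃` realizes `d₁` as a subfamily sum disjoint from `C₁`, so `c₁ ⊕ d₁` is
  -- a subfamily sum; the other summand is its difference from `c`.
  obtain ⟨mu, mw, hmu, -, hsplit⟩ := exists_splitsTo_of_le hhom C₃ R₁ (R₂ + R) e₁ c₃ d₁ f₁ he₁ hc₃
    hf₁ (le_of_add hd) ((le_of_add he).trans hec₃)
  have hcd₁ : ∃ x, some c₁ + some d₁ = some x ∧ x ≤ a := by
    rw [← hf₁, ← add_assoc] at hce₁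
    obtain ⟨x, _, hx, -⟩ := exists_of_add_eq_some hce₁
    exact ⟨x, hx, le_of_add (by rwa [hx] at hce₁)⟩
  have hcd₂ : ∃ x, some c₂ + some d₂ = some x ∧ x ≤ b := by
    obtain ⟨f₂, hf₂⟩ := exists_add_of_le hd₂
    rw [← hf₂, ← add_assoc] at hce₂
    obtain ⟨x, _, hx, -⟩ := exists_of_add_eq_some hce₂
    exact ⟨x, hx, le_of_add (by rwa [hx] at hce₂)⟩
  obtain ⟨x₁, hx₁, hx₁a⟩ := hcd₁
  obtain ⟨x₂, hx₂, hx₂b⟩ := hcd₂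
  have hx : some x₁ + some x₂ = some c := by
    rw [← hx₁, ← hx₂, add_add_add_comm, hd, hc₁₂, hc₁₂₃]
  have hx₁M : x₁ ∈ partitionSums B := by
    refine ⟨C₁ + mu, mw + C₃ + R₂ + R₃ + C₂, ?_, by rw [msum_add, hc₁, hmu, hx₁]⟩
    rw [hR, add_assoc] at hU
    convert hU.splitsTo hsplit using 1
    rw [hR']
    abel
  have hcM : c ∈ partitionSums B := ⟨_, _, hQ, by
    rw [← hC.msum_eq]
    exact hc⟩
  exact ⟨x₁, hx₁M, x₂, partitionSums_right_mem hhom hB hx hx₁M hcM, hx₁a, hx₂b, hx⟩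

/-- A block contains every element below both `x` and `x'` for some member `x`. -/
theorem IsBlock.mem_of_le (hhom : IsHomogeneous E) (hB : B.IsBlock) {u x : E}
    (hx : x ∈ B.carrier) (hu : u ≤ x) (hu' : u ≤ compl x) : u ∈ B.carrier := by
  have h : partitionSubalgebra hhom hB.prop ≤ B :=
    hB.le_of_ge (hasRDP_partitionSubalgebra hhom hB.prop)
      (show B.carrier ⊆ partitionSums B from subset_partitionSums)
  exact h (mem_partitionSums_of_le hx hu hu')

end Refinement

end SubEffectAlgebra

namespace EffectAlgebra

/-! ### Lower bounds that cannot be enlarged -/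

section MaximalLowerBound

variable {E : Type u} [EffectAlgebra E]

/-- In an orthocomplete effect algebra any two elements have a maximal lower bound. -/
theorem IsOrthocomplete.exists_maximal_lowerBound (h : IsOrthocomplete E) (x y : E) :
    ∃ w, w ≤ x ∧ w ≤ y ∧ ∀ d t, some w + some d = some t → t ≤ x → t ≤ y → d = 0 := by
  classical
  -- The label in `ℕ` lets an element occur repeatedly in the orthogonal system.
  let good : Set (Set (E × ℕ)) := {H | ∀ K : Finset (E × ℕ), (K : Set (E × ℕ)) ⊆ H →
    ∃ s, finOrthosum Prod.fst K = some s ∧ s ≤ x ∧ s ≤ y}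
  obtain ⟨H, hH⟩ : ∃ H, Maximal (· ∈ good) H := by
    refine zorn_subset good fun c hc hchain => ?_
    by_cases hne : c.Nonempty
    · refine ⟨⋃₀ c, fun K hK => ?_, fun s hs => Set.subset_sUnion_of_mem hs⟩
      obtain ⟨H, hHc, hKH⟩ := DirectedOn.exists_mem_subset_of_finset_subset_biUnion
        (f := id) hne (by simpa [directedOn_onFun_iff] using hchain.directedOn)
        (by simpa [Set.sUnion_eq_biUnion] using hK)
      exact hc hHc K hKH
    · refine ⟨∅, fun K hK => ?_, fun s hs => (hne ⟨s, hs⟩).elim⟩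
      obtain rfl : K = ∅ := by simpa [Set.subset_empty_iff] using hK
      exact ⟨0, rfl, zero_le x, zero_le y⟩
  let f : H → E := fun i => i.1.1
  have hsum : ∀ K : Finset H, finOrthosum f K =
      finOrthosum Prod.fst (K.map (Function.Embedding.subtype _)) := by
    intro K
    rw [finOrthosum, finOrthosum, Finset.fold_map]
    rfl
  have hgood : ∀ K : Finset H, ∃ s, finOrthosum f K = some s ∧ s ≤ x ∧ s ≤ y := by
    intro K
    rw [hsum]
    refine hH.prop _ ?_
    simp
  obtain ⟨w, hw⟩ := h H f (fun K => (hgood K).imp fun _ hs => hs.1) ⟨x, by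
    rintro s ⟨K, hK⟩
    obtain ⟨t, ht, htx, -⟩ := hgood K
    rw [hK] at ht
    exact Option.some.inj ht ▸ htx⟩
  have hlower : ∀ z, (∀ K s, finOrthosum f K = some s → s ≤ z) → w ≤ z :=
    fun z hz => hw.2 (by rintro s ⟨K, hK⟩; exact hz K s hK)
  have hwx : w ≤ x := hlower x fun K s hK => by
    obtain ⟨t, ht, htx, -⟩ := hgood K
    rw [hK] at ht
    exact Option.some.inj ht ▸ htx
  have hwy : w ≤ y := hlower y fun K s hK => by
    obtain ⟨t, ht, -, hty⟩ := hgood K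
    rw [hK] at ht
    exact Option.some.inj ht ▸ hty
  refine ⟨w, hwx, hwy, fun d t hdt htx hty => ?_⟩
  have hsub : ∀ K : Finset (E × ℕ), (K : Set (E × ℕ)) ⊆ H → ∃ s, finOrthosum Prod.fst K = some s ∧
      s ≤ w := by
    intro K hK
    obtain ⟨s, hs, -⟩ := hH.prop K hK
    refine ⟨s, hs, hw.1 ⟨K.subtype (· ∈ H), ?_⟩⟩
    rw [hsum]
    convert hs
    ext i
    simpa using fun hi => hK hi
  have hadd : ∀ s, s ≤ w → ∃ r, some s + some d = some r ∧ r ≤ t := by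
    intro s hs
    obtain ⟨e, he⟩ := exists_add_of_le hs
    rw [← he, add_right_comm] at hdt
    obtain ⟨r, _, hr, -⟩ := exists_of_add_eq_some hdt
    exact ⟨r, hr, le_of_add (by rwa [hr] at hdt)⟩
  -- A finite sum is at most `w`, so adding one `d` keeps it below `t`. By maximality, all labelled
  -- copies of `d` already belong to `H`.
  have hmem : ∀ n : ℕ, (d, n) ∈ H := by
    intro n
    have : insert (d, n) H ∈ good := by
      intro K hK
      by_cases hn : (d, n) ∈ K ∧ (d, n) ∉ H
      · obtain ⟨s, hs, hsw⟩ := hsub (K.erase (d, n)) (by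
          intro i hi
          rw [Finset.coe_erase] at hi
          exact (hK hi.1).resolve_left hi.2)
        obtain ⟨r, hr, hrt⟩ := hadd s hsw
        refine ⟨r, ?_, hrt.trans htx, hrt.trans hty⟩
        rw [← Finset.insert_erase hn.1, finOrthosum_insert _ (Finset.notMem_erase _ _), hs]
        exact hr
      · refine hH.prop K fun i hi => ?_
        rcases hK hi with rfl | hi'
        · by_contra hc
          exact hn ⟨hi, hc⟩
        · exact hi'
    exact hH.le_of_ge this (Set.subset_insert _ _) (Set.mem_insert _ _)
  -- Here `n` is the element `w ⊖ d`.
  obtain ⟨n, hn⟩ : ∃ v, some v + some d = some w := by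
    obtain ⟨s, hs, hsw⟩ := hsub {(d, 0)} (by simpa using hmem 0)
    have hs' : finOrthosum Prod.fst {(d, 0)} = some 0 + some d := by
      rw [← insert_empty_eq, finOrthosum_insert _ (Finset.notMem_empty _), finOrthosum_empty]
      rfl
    rw [hs', some_zero, zero_add] at hs
    obtain ⟨v, hv⟩ := exists_add_of_le hsw
    exact ⟨v, by rw [add_comm, hs, hv]⟩
  have hle : w ≤ n := by
    refine hlower n fun K s hK => ?_
    rw [hsum] at hK
    set K' := K.map (Function.Embedding.subtype _) with hK'
    -- Some copy of `d` is not used in the finite sum `s`; adjoining it gives `s ⊕ d ≤ w`, so `w ⊖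
    -- d` is already an upper bound.
    obtain ⟨m, hm⟩ : ∃ m : ℕ, (d, m) ∉ K' := by
      by_contra! hc
      exact Set.infinite_of_injective_forall_mem (Prod.mk_right_injective d) hc
        K'.finite_toSet
    obtain ⟨s', hs', hsw⟩ := hsub (insert (d, m) K') (by
      intro i hi
      rw [Finset.coe_insert] at hi
      rcases hi with rfl | hi
      · exact hmem m
      · obtain ⟨j, -, rfl⟩ := Finset.mem_map.1 hi
        exact j.2)
    rw [finOrthosum_insert _ hm, hK] at hs'
    change some s + some d = some s' at hs'
    rw [add_comm] at hs' hn
    exact le_of_add_le_add hs' hn hsw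
  have := le_antisymm hle (le_of_add hn)
  rw [← this] at hn
  exact Option.some.inj (add_left_cancel_some hn (add_zero (some w)))

end MaximalLowerBound

/-! ### Meets from RDP, and the MV-algebra of an MV-effect algebra -/

section Lattice

variable {L : Type u} [EffectAlgebra L]

/-- In an effect algebra with the Riesz decomposition property, a lower bound that cannot be
enlarged is the greatest lower bound. -/
theorem HasRDP.isGLB_of_maximal (hL : HasRDP L) {x y g x₁ y₁ : L}
    (hx : some g + some x₁ = some x) (hy : some g + some y₁ = some y)
    (h : ∀ d, d ≤ x₁ → d ≤ y₁ → d = 0) : IsGLB {x, y} g := by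
  refine ⟨by simp [le_of_add hx, le_of_add hy], fun z hz => ?_⟩
  have hzx : z ≤ x := hz (by simp)
  have hzy : z ≤ y := hz (by simp)
  obtain ⟨z₁, z₂, hz₁, hz₂, hz₁₂⟩ := hL z g x₁ x hx hzx
  change some z₁ + some z₂ = some z at hz₁₂
  obtain ⟨g₁, hg₁⟩ := exists_add_of_le hz₁
  rw [← hg₁, add_assoc] at hy
  obtain ⟨_, r, -, hr⟩ := exists_of_add_eq_some hy
  rw [hr] at hy
  -- The piece `f` lies below both `x₁` and `y₁` and so vanishes; hence `z = z₁ ⊕ e ≤ z₁ ⊕ g₁ = g`.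
  obtain ⟨e, f, he, hf, hef⟩ := hL z₂ g₁ y₁ r hr (le_of_add_le_add hz₁₂ hy hzy)
  change some e + some f = some z₂ at hef
  obtain rfl := h f ((le_of_add ((add_comm _ _).trans hef)).trans hz₂) hf
  rw [some_zero, add_zero] at hef
  obtain rfl := Option.some.inj hef
  exact add_le_add_some le_rfl he hz₁₂ hg₁

theorem isLatticeOrdered_of_exists_isGLB (h : ∀ x y : L, ∃ i, IsGLB {x, y} i) :
    IsLatticeOrdered L := by
  refine fun x y => ⟨?_, h x y⟩
  obtain ⟨i, hi⟩ := h (compl x) (compl y)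
  refine ⟨compl i, ?_, fun z hz => ?_⟩
  · rintro z (rfl | rfl)
    · exact le_compl_comm (hi.1 (by simp))
    · exact le_compl_comm (hi.1 (by simp))
  · have hzi : compl z ≤ i := hi.2 (by
      rintro t (rfl | rfl)
      · exact compl_le_compl (hz (by simp))
      · exact compl_le_compl (hz (by simp)))
    simpa [compl_compl] using compl_le_compl hzi

/-- `z` is the greatest of all sums `a ⊕ b` with `a ≤ x` and `b ≤ y`. -/
def IsTruncatedSum (x y z : L) : Prop :=
  IsGreatest {s | ∃ a b, a ≤ x ∧ b ≤ y ∧ some a + some b = some s} z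

theorem IsTruncatedSum.symm {x y z : L} (h : IsTruncatedSum x y z) : IsTruncatedSum y x z := by
  have e : {s : L | ∃ a b, a ≤ y ∧ b ≤ x ∧ some a + some b = some s} =
      {s | ∃ a b, a ≤ x ∧ b ≤ y ∧ some a + some b = some s} := by
    ext s
    constructor <;>
    · rintro ⟨a, b, ha, hb, hs⟩
      exact ⟨b, a, hb, ha, (add_comm _ _).trans hs⟩
  rw [IsTruncatedSum, e]
  exact h

/-- This characterization of `x ⊕ (x' ∧ y)` is symmetric in `x` and `y`, which yields commutativity.
For the bound, write `x = a ⊕ d` and split `b ≤ a' = x' ⊕ d`: the piece below `d` is absorbed into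
`x`, and the other lies below `x' ∧ y`. -/
theorem isTruncatedSum_of_isGLB (hL : HasRDP L) {x y i z : L} (hi : IsGLB {compl x, y} i)
    (hz : some x + some i = some z) : IsTruncatedSum x y z := by
  refine ⟨⟨x, i, le_rfl, hi.1 (by simp), hz⟩, ?_⟩
  rintro s ⟨a, b, ha, hb, hs⟩
  obtain ⟨d, hd⟩ := exists_add_of_le ha
  have had : some (compl x) + some d = some (compl a) := by
    have h1 := add_compl x
    rw [← hd, add_assoc] at h1
    obtain ⟨_, r, -, hr⟩ := exists_of_add_eq_some h1
    rw [hr] at h1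
    rw [← eq_compl h1, ← hr, add_comm]
  obtain ⟨t₁, t₂, ht₁, ht₂, ht⟩ := hL b (compl x) d (compl a) had
    (le_compl_of_add ((add_comm _ _).trans hs))
  change some t₁ + some t₂ = some b at ht
  have ht₁i : t₁ ≤ i := hi.2 (by
    rintro c (rfl | rfl)
    · exact ht₁
    · exact (le_of_add ht).trans hb)
  rw [← ht, add_comm (some t₁), ← add_assoc] at hs
  obtain ⟨r, _, hr, -⟩ := exists_of_add_eq_some hs
  rw [hr] at hs
  exact add_le_add_some (add_le_add_some le_rfl ht₂ hr hd) ht₁i hs hz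

/-- RDP regroups a sum below `(x + y) + z` as one below `x + (y + z)`. With commutativity, this one
inequality gives associativity. -/
theorem IsTruncatedSum.le_of_assoc (hL : HasRDP L) {x y z s t r q : L}
    (hs : IsTruncatedSum x y s) (hr : IsTruncatedSum s z r) (ht : IsTruncatedSum y z t)
    (hq : IsTruncatedSum x t q) : r ≤ q := by
  obtain ⟨⟨d, c, hd, hc, hdc⟩, -⟩ := hr
  obtain ⟨⟨a, b, ha, hb, hab⟩, -⟩ := hs
  obtain ⟨a', b', ha', hb', hab'⟩ := hL d a b s hab hd
  change some a' + some b' = some d at hab'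
  rw [← hab', add_assoc] at hdc
  obtain ⟨_, e, -, he⟩ := exists_of_add_eq_some hdc
  rw [he] at hdc
  exact hq.2 ⟨a', e, ha'.trans ha, ht.2 ⟨b', c, hb'.trans hb, hc, he⟩, hdc⟩

/-- Every MV-effect algebra is induced by an MV-algebra. -/
theorem IsMVEffectAlgebra.exists_mvAlgebra (h : IsMVEffectAlgebra L) :
    ∃ A : MVAlgebra L, A.Induces := by
  have hL := h.2
  have hex : ∀ x y : L, ∃ i z, IsGLB {compl x, y} i ∧ some x + some i = some z := by
    intro x y
    obtain ⟨i, hi⟩ := (h.1 (compl x) y).2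
    obtain ⟨z, hz⟩ := add_of_le_compl (hi.1 (show compl x ∈ _ by simp))
    exact ⟨i, z, hi, (add_comm _ _).trans hz⟩
  choose inf add hinf hadd using hex
  have htrunc : ∀ x y, IsTruncatedSum x y (add x y) := fun x y =>
    isTruncatedSum_of_isGLB hL (hinf x y) (hadd x y)
  have hcomm : ∀ x y, add x y = add y x := fun x y => (htrunc x y).unique (htrunc y x).symm
  have hle : ∀ x y z, add (add x y) z ≤ add x (add y z) := fun x y z =>
    IsTruncatedSum.le_of_assoc hL (htrunc _ _) (htrunc _ _) (htrunc _ _) (htrunc _ _)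
  have hinf_eq : ∀ {x y i : L}, IsGLB {compl x, y} i → inf x y = i := fun hi =>
    (hinf _ _).unique hi
  have hadd_eq : ∀ {x y z : L}, some x + some y = some z → add x y = z := by
    intro x y z hz
    have hi : inf x y = y := hinf_eq (by
      refine ⟨?_, fun t ht => ht (by simp)⟩
      rintro t (rfl | rfl)
      · exact le_compl_of_add ((add_comm _ _).trans hz)
      · exact le_rfl)
    have := hadd x y
    rw [hi, hz] at this
    exact (Option.some.inj this).symm
  have hzero : compl (0 : L) = 1 := (eq_compl (zero_add (some (1 : L)))).symm
  have hone : ∀ x : L, add x 1 = 1 := by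
    intro x
    have hi : inf x 1 = compl x := hinf_eq (by
      refine ⟨?_, fun t ht => ht (by simp)⟩
      rintro t (rfl | rfl)
      · exact le_rfl
      · exact le_one _)
    have := hadd x 1
    rw [hi, add_compl] at this
    exact (Option.some.inj this).symm
  -- The left side is `(y' ∧ x')'`, that is `x ∨ y`, which is symmetric in `x` and `y`.
  have hluk : ∀ x y : L, add (compl (add (compl x) y)) y = compl (inf y (compl x)) := by
    intro x y
    set k := compl (add (compl x) y) with hk
    have h1 : some y + (some k + some (inf y (compl x))) = some 1 := by
      rw [add_comm (some k), ← add_assoc, hadd, hcomm y, hk, add_compl]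
    rw [← add_assoc, add_comm (some y)] at h1
    obtain ⟨s, _, hs, -⟩ := exists_of_add_eq_some h1
    rw [hs, add_comm] at h1
    rw [hadd_eq hs, eq_compl h1]
  refine ⟨⟨add, compl, 0, fun x y z => ?_, hcomm, fun x => hadd_eq (add_zero (some x)),
    compl_compl, fun x => by rw [hzero, hone], fun x y => ?_⟩, rfl, fun _ => rfl, fun x y z => ?_⟩
  · refine le_antisymm (hle x y z) ?_
    have := hle z y x
    rwa [hcomm (add z y) x, hcomm z y, hcomm z, hcomm y x] at this
  · rw [hluk, hluk]
    congr 1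
    refine hinf_eq ?_
    rw [Set.pair_comm]
    exact hinf x (compl y)
  · change some x + some y = some z ↔ add (compl x) (compl y) = compl 0 ∧ add x y = z
    rw [hzero]
    constructor
    · intro hz
      have hi : inf (compl x) (compl y) = x := hinf_eq (by
        rw [compl_compl]
        refine ⟨?_, fun t ht => ht (by simp)⟩
        rintro t (rfl | rfl)
        · exact le_rfl
        · exact le_compl_of_add hz)
      have := hadd (compl x) (compl y)
      rw [hi, add_comm, add_compl] at this
      exact ⟨(Option.some.inj this).symm, hadd_eq hz⟩
    · rintro ⟨h1, rfl⟩
      have h2 := hadd (compl x) (compl y)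
      rw [h1] at h2
      have h3 := eq_compl h2
      rw [compl_compl] at h3
      have hxy : x ≤ compl y := by
        rw [← h3]
        exact (hinf (compl x) (compl y)).1 (by simp)
      obtain ⟨z, hz⟩ := add_of_le_compl hxy
      rw [hz, hadd_eq hz]

end Lattice

end EffectAlgebra

/-! ### Meets in blocks -/

namespace SubEffectAlgebra

open EffectAlgebra

theorem IsBlock.exists_isGLB {E : Type u} [EffectAlgebra E] {B : SubEffectAlgebra E}
    (hhom : IsHomogeneous E) (horth : IsOrthocomplete E) (hB : B.IsBlock) (x y : B.Elem) :
    ∃ i, IsGLB {x, y} i := by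
  have hL : HasRDP B.Elem := hB.prop
  -- Splitting `x` along `1 = y ⊕ y'` makes `q ≤ y'` orthogonal to `r = y ⊖ p`.
  obtain ⟨p, q, hp, hq, hpq⟩ := hL x y (compl y) 1 (oplus_compl y) (le_one x)
  change some p + some q = some x at hpq
  obtain ⟨r, hr⟩ := exists_add_of_le hp
  have hqr : r ≤ compl q := (le_of_add ((add_comm _ _).trans hr)).trans (le_compl_comm hq)
  obtain ⟨s, hs⟩ := add_of_le_compl hqr
  have hqr' : r.val ≤ compl q.val := le_compl_of_add (B.oplusElem_eq_some_iff.1 hs)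
  -- The bound is found in `E`, but `w ≤ q` and `w ≤ r ≤ q'` place it in the block.
  obtain ⟨w, hwq, hwr, hmax⟩ := horth.exists_maximal_lowerBound q.val r.val
  have hw : w ∈ B.carrier := hB.mem_of_le hhom q.val_mem hwq (hwr.trans hqr')
  let v : B.Elem := ⟨w, hw⟩
  obtain ⟨q₁, hq₁⟩ := exists_add_of_le (Elem.le_iff.2 hwq : v ≤ q)
  obtain ⟨r₁, hr₁⟩ := exists_add_of_le (Elem.le_iff.2 hwr : v ≤ r)
  rw [← hq₁, ← add_assoc] at hpq
  obtain ⟨g, _, hg, -⟩ := exists_of_add_eq_some hpq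
  rw [← hr₁, ← add_assoc] at hr
  rw [hg] at hpq hr
  refine ⟨g, hL.isGLB_of_maximal hpq hr fun d hdq hdr => ?_⟩
  -- A common lower bound `d` of the remainders would enlarge `w` to `w ⊕ d`, still below `q` and
  -- `r`.
  obtain ⟨t, ht⟩ := add_of_le_compl
    ((le_compl_of_add hq₁).trans (compl_le_compl hdq))
  exact Elem.val_injective (hmax d.val t.val (B.oplusElem_eq_some_iff.1 ht)
    (Elem.le_iff.1 (add_le_add_some le_rfl hdq ht hq₁))
    (Elem.le_iff.1 (add_le_add_some le_rfl hdr ht hr₁)))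

end SubEffectAlgebra

theorem corollary3p17 (E : Type u) [EffectAlgebra E]
    (hhom : EffectAlgebra.IsHomogeneous E) (horth : EffectAlgebra.IsOrthocomplete E)
    (B : SubEffectAlgebra E) (hB : B.IsBlock) :
    EffectAlgebra.IsMVEffectAlgebra B.Elem ∧ ∃ A : MVAlgebra B.Elem, A.Induces := by
  have h : EffectAlgebra.IsMVEffectAlgebra B.Elem :=
    ⟨EffectAlgebra.isLatticeOrdered_of_exists_isGLB (hB.exists_isGLB hhom horth), hB.prop⟩
  exact ⟨h, h.exists_mvAlgebra⟩
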